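/- Consider Bell tests with $n$ parties, where party $j$ receives an input bit $s_j$ and returns an output bit $m_j$; the correlator vector of conditional probabilities $p(\mathbf m|\mathbf s)$ is $p(1|\mathbf s)=\sum_{\mathbf m:\,m_1\oplus\cdots\oplus m_n=1}p(\mathbf m|\mathbf s)$, $\mathbf s\in\{0,1\}^n$. It is a local hidden variable (LHV) correlator if $p(\mathbf m|\mathbf s)=\sum_{g_1,\dots,g_n}p_{g_1,\dots,g_n}\prod_j\delta^{m_j}_{g_j(s_j)}$, a convex combination over maps $g_j:\{0,1\}\to\{0,1\}$. It is a quantum correlator if $p(\mathbf m|\mathbf s)=\mathrm{Tr}\big(\rho\bigotimes_{j=1}^nP^{s_j}_{m_j}\big)$ for some complex Hilbert spaces $\mathcal H_1,\dots,\mathcal H_n$ of arbitrary (possibly infinite) dimension, a density matrix $\rho$ on $\bigotimes_j\mathcal H_j$, and for each party $j$ and input $s_j$ a two-outcome POVM $\{P^{s_j}_{0},P^{s_j}_{1}\}$ on $\mathcal H_j$. Let $f(\mathbf s)=s_1s_2\cdots s_n\oplus1$ be the $n$-partite NAND function. For every $n\ge3$, the inequality $$\frac1{2^n}\sum_{\mathbf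 s\in\{0,1\}^n}(-1)^{f(\mathbf s)+1}\,p(1|\mathbf s)\;\le\;\frac{2^n-2}{2^n}$$ is a non-trivial Bell inequality, that is, its right-hand side is the maximum of the left-hand side over all LHV correlators, while some vector $\big(p(1|\mathbf s)\big)_{\mathbf s}$ with entries in $[0,1]$ violates it; and it is not violated by quantum correlators: every quantum correlator satisfies it. -/

import Mathlib

universe u

noncomputable section

open scoped InnerProductSpace TensorProduct ComplexOrder ComplexConjugate

namespace Bell

/-! ### The Hilbert space tensor product of a finite family of complex Hilbert spaces

The algebraic tensor product carries the positive semidefinite Hermitian form determined by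
`⟪⨂ x_j, ⨂ y_j⟫ = ∏ ⟪x_j, y_j⟫`; the Hilbert space tensor product is the completion. -/

section Hilbert

variable {ι : Type} (H : ι → Type u) [∀ j, NormedAddCommGroup (H j)]
  [∀ j, InnerProductSpace ℂ (H j)]

/-- The algebraic tensor product `⨂ H_j` (a type synonym, which does not inherit the projective
seminorm from Mathlib). -/
def AlgTensor : Type _ := ⨂[ℂ] j, H j

instance : AddCommGroup (AlgTensor H) := inferInstanceAs (AddCommGroup (⨂[ℂ] j, H j))

instance : Module ℂ (AlgTensor H) := inferInstanceAs (Module ℂ (⨂[ℂ] j, H j))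

/-- Elementary tensors in the algebraic tensor product. -/
def AlgTensor.tprod : MultilinearMap ℂ H (AlgTensor H) := PiTensorProduct.tprod ℂ

variable {H}

theorem AlgTensor.exists_rep (u : AlgTensor H) :
    ∃ (κ : Type) (_ : Fintype κ) (c : κ → ℂ) (x : κ → ∀ j, H j),
      u = ∑ k, c k • AlgTensor.tprod H (x k) := by
  refine PiTensorProduct.induction_on u ?_ ?_
  · intro r f
    exact ⟨Unit, inferInstance, fun _ => r, fun _ => f,
      (Fintype.sum_unique fun _ : Unit => r • AlgTensor.tprod H f).symm⟩
  · rintro _ _ ⟨κ, _, c, x, rfl⟩ ⟨κ', _, c', x', rfl⟩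
    exact ⟨κ ⊕ κ', inferInstance, Sum.elim c c', Sum.elim x x',
      (Fintype.sum_sum_type fun k => Sum.elim c c' k • AlgTensor.tprod H (Sum.elim x x' k)).symm⟩

/-- The algebraic tensor product of bounded operators, `⨂ x_j ↦ ⨂ A_j x_j`. -/
def AlgTensor.map (A : ∀ j, H j →L[ℂ] H j) : AlgTensor H →ₗ[ℂ] AlgTensor H :=
  PiTensorProduct.map fun j => (A j).toLinearMap

theorem AlgTensor.map_tprod (A : ∀ j, H j →L[ℂ] H j) (x : ∀ j, H j) :
    AlgTensor.map A (AlgTensor.tprod H x) = AlgTensor.tprod H fun j => A j (x j) :=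
  PiTensorProduct.map_tprod _ x

/-- Monotonicity of entrywise products of positive semidefinite matrices. -/
theorem posSemidef_prod_sub {κ : Type} [Fintype κ] (S : Finset ι) (A B : ι → Matrix κ κ ℂ)
    (hA : ∀ j, (A j).PosSemidef) (hAB : ∀ j, (B j - A j).PosSemidef) :
    (Matrix.of fun k l => ∏ j ∈ S, A j k l).PosSemidef ∧
      (Matrix.of fun k l => ∏ j ∈ S, B j k l - ∏ j ∈ S, A j k l).PosSemidef := by
  classical
  induction S using Finset.induction_on with
  | empty =>
    constructor
    · have e : (Matrix.of fun k l => ∏ j ∈ (∅ : Finset ι), A j k l) =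
          Matrix.gram ℂ (fun _ : κ => (1 : ℂ)) := by
        ext k l
        simp
      rw [e]
      exact Matrix.posSemidef_gram ℂ _
    · have e : (Matrix.of fun k l => ∏ j ∈ (∅ : Finset ι), B j k l -
          ∏ j ∈ (∅ : Finset ι), A j k l) = 0 := by
        ext k l
        simp
      rw [e]
      exact Matrix.PosSemidef.zero
  | insert i S hi ih =>
    obtain ⟨h1, h2⟩ := ih
    constructor
    · have e : (Matrix.of fun k l => ∏ j ∈ insert i S, A j k l) =
          (A i).hadamard (Matrix.of fun k l => ∏ j ∈ S, A j k l) := by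
        ext k l
        simp [Finset.prod_insert hi]
      rw [e]
      exact (hA i).hadamard h1
    · have hB : (B i).PosSemidef := by simpa using (hAB i).add (hA i)
      have e : (Matrix.of fun k l => ∏ j ∈ insert i S, B j k l - ∏ j ∈ insert i S, A j k l) =
          (B i).hadamard (Matrix.of fun k l => ∏ j ∈ S, B j k l - ∏ j ∈ S, A j k l) +
            (B i - A i).hadamard (Matrix.of fun k l => ∏ j ∈ S, A j k l) := by
        ext k l
        simp [Finset.prod_insert hi]
        ring
      rw [e]
      exact (hB.hadamard h2).add ((hAB i).hadamard h1)

theorem quadForm_nonneg {κ : Type} [Fintype κ] {M : Matrix κ κ ℂ} (hM : M.PosSemidef)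
    (c : κ → ℂ) : 0 ≤ ∑ k, ∑ l, conj (c k) * c l * M k l := by
  have h := hM.dotProduct_mulVec_nonneg c
  convert h using 1
  simp only [dotProduct, Matrix.mulVec, Pi.star_apply, Finset.mul_sum, RCLike.star_def]
  exact Finset.sum_congr rfl fun k _ => Finset.sum_congr rfl fun l _ => by ring

variable [Fintype ι]

/-- The linear functional `⨂ y_j ↦ ∏ ⟪x_j, y_j⟫`. -/
def AlgTensor.pairLeft (x : ∀ j, H j) : AlgTensor H →ₗ[ℂ] ℂ :=
  PiTensorProduct.lift ((MultilinearMap.mkPiAlgebra ℂ ι ℂ).compLinearMap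
    (fun j => (innerSL ℂ (x j)).toLinearMap))

theorem AlgTensor.pairLeft_tprod (x y : ∀ j, H j) :
    AlgTensor.pairLeft x (AlgTensor.tprod H y) = ∏ j, ⟪x j, y j⟫_ℂ := by
  exact (PiTensorProduct.lift.tprod y).trans (by simp)

theorem AlgTensor.pairLeft_conj (x y : ∀ j, H j) :
    conj (AlgTensor.pairLeft x (AlgTensor.tprod H y)) =
      AlgTensor.pairLeft y (AlgTensor.tprod H x) := by
  simp [AlgTensor.pairLeft_tprod, map_prod]

/-- The linear functional `⨂ x_j ↦ conj ⟪⨂ x_j, t⟫ = ⟪t, ⨂ x_j⟫`. -/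
def AlgTensor.pairRight (t : AlgTensor H) : AlgTensor H →ₗ[ℂ] ℂ :=
  PiTensorProduct.lift
    { toFun := fun x => conj (AlgTensor.pairLeft x t)
      map_update_add' := by
        intro _ x i a b
        obtain ⟨κ, _, c, y, rfl⟩ := AlgTensor.exists_rep t
        simp only [map_sum, map_smul, smul_eq_mul, map_mul, AlgTensor.pairLeft_conj,
          MultilinearMap.map_update_add, map_add, mul_add, Finset.sum_add_distrib]
      map_update_smul' := by
        intro _ x i r a
        obtain ⟨κ, _, c, y, rfl⟩ := AlgTensor.exists_rep t
        simp only [map_sum, map_smul, smul_eq_mul, map_mul, AlgTensor.pairLeft_conj,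
          MultilinearMap.map_update_smul, Finset.mul_sum]
        exact Finset.sum_congr rfl fun k _ => by ring }

theorem AlgTensor.pairRight_tprod (t : AlgTensor H) (x : ∀ j, H j) :
    AlgTensor.pairRight t (AlgTensor.tprod H x) = conj (AlgTensor.pairLeft x t) :=
  PiTensorProduct.lift.tprod x

/-- The Hermitian form on the algebraic tensor product, conjugate linear in the first variable. -/
def AlgTensor.form (u t : AlgTensor H) : ℂ := conj (AlgTensor.pairRight t u)

theorem AlgTensor.form_sum {κ κ' : Type} [Fintype κ] [Fintype κ'] (c : κ → ℂ)
    (x : κ → ∀ j, H j) (d : κ' → ℂ) (y : κ' → ∀ j, H j) :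
    AlgTensor.form (∑ k, c k • AlgTensor.tprod H (x k)) (∑ l, d l • AlgTensor.tprod H (y l)) =
      ∑ k, ∑ l, conj (c k) * d l * ∏ j, ⟪x k j, y l j⟫_ℂ := by
  simp only [AlgTensor.form, map_sum, map_smul, smul_eq_mul, map_mul, AlgTensor.pairRight_tprod,
    Complex.conj_conj, AlgTensor.pairLeft_tprod, Finset.mul_sum, mul_assoc]

theorem AlgTensor.form_tprod (x y : ∀ j, H j) :
    AlgTensor.form (AlgTensor.tprod H x) (AlgTensor.tprod H y) = ∏ j, ⟪x j, y j⟫_ℂ := by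
  simp [AlgTensor.form, AlgTensor.pairRight_tprod, AlgTensor.pairLeft_tprod]

variable (H) in
/-- The Hermitian form makes the algebraic tensor product a pre-Hilbert space. -/
@[reducible]
def AlgTensor.core : PreInnerProductSpace.Core ℂ (AlgTensor H) where
  inner := AlgTensor.form
  conj_inner_symm u t := by
    obtain ⟨κ, _, c, x, rfl⟩ := AlgTensor.exists_rep u
    obtain ⟨κ', _, d, y, rfl⟩ := AlgTensor.exists_rep t
    simp only [AlgTensor.form_sum, map_sum, map_mul, map_prod, inner_conj_symm, Complex.conj_conj]
    rw [Finset.sum_comm]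
    exact Finset.sum_congr rfl fun k _ => Finset.sum_congr rfl fun l _ => by ring
  re_inner_nonneg u := by
    obtain ⟨κ, _, c, x, rfl⟩ := AlgTensor.exists_rep u
    rw [AlgTensor.form_sum]
    have h := (posSemidef_prod_sub Finset.univ (fun j => Matrix.gram ℂ fun k => x k j)
      (fun j => Matrix.gram ℂ fun k => x k j) (fun j => Matrix.posSemidef_gram ℂ _)
      (fun j => by simpa using Matrix.PosSemidef.zero)).1
    exact (Complex.le_def.1 (quadForm_nonneg h c)).1
  add_left u t z := by simp [AlgTensor.form]
  smul_left u t r := by simp [AlgTensor.form]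

instance : SeminormedAddCommGroup (AlgTensor H) :=
  @InnerProductSpace.Core.toSeminormedAddCommGroup ℂ (AlgTensor H) _ _ _ (AlgTensor.core H)

instance : InnerProductSpace ℂ (AlgTensor H) := InnerProductSpace.ofCore (AlgTensor.core H)

theorem AlgTensor.inner_eq (u t : AlgTensor H) : ⟪u, t⟫_ℂ = AlgTensor.form u t := rfl

theorem AlgTensor.norm_map_le (A : ∀ j, H j →L[ℂ] H j) (u : AlgTensor H) :
    ‖AlgTensor.map A u‖ ≤ (∏ j, ‖A j‖) * ‖u‖ := by
  obtain ⟨κ, _, c, x, rfl⟩ := AlgTensor.exists_rep u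
  have hG : ∀ j, ((Matrix.of fun k l => ((‖A j‖ ^ 2 : ℝ) : ℂ) * ⟪x k j, x l j⟫_ℂ) -
      Matrix.gram ℂ fun k => A j (x k j) : Matrix κ κ ℂ).PosSemidef := by
    intro j
    refine Matrix.PosSemidef.of_dotProduct_mulVec_nonneg ?_ fun d => ?_
    · ext k l
      simp only [Matrix.conjTranspose_apply, Matrix.sub_apply, Matrix.of_apply, Matrix.gram_apply,
        star_sub, star_mul', RCLike.star_def, Complex.conj_ofReal, inner_conj_symm]
    · have e : star d ⬝ᵥ ((Matrix.of fun k l => ((‖A j‖ ^ 2 : ℝ) : ℂ) * ⟪x k j, x l j⟫_ℂ) -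
          Matrix.gram ℂ fun k => A j (x k j) : Matrix κ κ ℂ).mulVec d =
          ((‖A j‖ ^ 2 * ‖∑ k, d k • x k j‖ ^ 2 - ‖A j (∑ k, d k • x k j)‖ ^ 2 : ℝ) : ℂ) := by
        have e1 := Matrix.star_dotProduct_gram_mulVec (𝕜 := ℂ) (fun k => x k j) d d
        have e2 := Matrix.star_dotProduct_gram_mulVec (𝕜 := ℂ) (fun k => A j (x k j)) d d
        have e3 : (Matrix.of fun k l => ((‖A j‖ ^ 2 : ℝ) : ℂ) * ⟪x k j, x l j⟫_ℂ) =
            ((‖A j‖ ^ 2 : ℝ) : ℂ) • Matrix.gram ℂ (fun k => x k j) := by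
          ext k l
          simp
        rw [e3, Matrix.sub_mulVec, dotProduct_sub, e2, Matrix.smul_mulVec, dotProduct_smul, e1,
          inner_self_eq_norm_sq_to_K, inner_self_eq_norm_sq_to_K, map_sum]
        simp
      rw [e, Complex.zero_le_real, sub_nonneg, ← mul_pow]
      exact pow_le_pow_left₀ (norm_nonneg _) ((A j).le_opNorm _) 2
  have hP := quadForm_nonneg (posSemidef_prod_sub Finset.univ
    (fun j => Matrix.gram ℂ fun k => A j (x k j)) _ (fun j => Matrix.posSemidef_gram ℂ _) hG).2 c
  have h1 : ∀ v : AlgTensor H, ‖v‖ ^ 2 = (AlgTensor.form v v).re := fun v =>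
    (InnerProductSpace.norm_sq_eq_re_inner (𝕜 := ℂ) v)
  refine abs_le_of_sq_le_sq' ?_ (by positivity) |>.2
  rw [mul_pow, h1, h1]
  simp only [map_sum, map_smul, AlgTensor.map_tprod]
  rw [AlgTensor.form_sum, AlgTensor.form_sum]
  have e : (∑ k, ∑ l, conj (c k) * c l * (Matrix.of fun k l =>
      ∏ j, (Matrix.of fun k l => ((‖A j‖ ^ 2 : ℝ) : ℂ) * ⟪x k j, x l j⟫_ℂ) k l -
        ∏ j, (Matrix.gram ℂ fun k => A j (x k j)) k l) k l) =
      (((∏ j, ‖A j‖) ^ 2 : ℝ) : ℂ) * (∑ k, ∑ l, conj (c k) * c l * ∏ j, ⟪x k j, x l j⟫_ℂ) -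
        ∑ k, ∑ l, conj (c k) * c l * ∏ j, ⟪A j (x k j), A j (x l j)⟫_ℂ := by
    simp only [Finset.mul_sum, ← Finset.sum_sub_distrib]
    refine Finset.sum_congr rfl fun k _ => Finset.sum_congr rfl fun l _ => ?_
    simp only [Matrix.of_apply, Matrix.gram_apply, Finset.prod_mul_distrib]
    push_cast
    rw [Finset.prod_pow]
    ring
  rw [e] at hP
  have hre := (Complex.le_def.1 hP).1
  rw [Complex.sub_re, Complex.re_ofReal_mul] at hre
  simpa using hre

/-- The Hilbert space tensor product `⨂ H_j`. -/
abbrev HilbertTensor (H : ι → Type u) [∀ j, NormedAddCommGroup (H j)]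
    [∀ j, InnerProductSpace ℂ (H j)] : Type _ := UniformSpace.Completion (AlgTensor H)

/-- The elementary tensor `⨂ x_j` in the Hilbert space tensor product. -/
def HilbertTensor.tprod (x : ∀ j, H j) : HilbertTensor H := (AlgTensor.tprod H x : AlgTensor H)

/-- The algebraic tensor product of bounded operators, as a bounded operator. -/
def AlgTensor.mapL (A : ∀ j, H j →L[ℂ] H j) : AlgTensor H →L[ℂ] AlgTensor H :=
  (AlgTensor.map A).mkContinuous _ (AlgTensor.norm_map_le A)

/-- The bounded operator `⨂ A_j` on the Hilbert space tensor product: the continuous extension of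
`⨂ x_j ↦ ⨂ A_j x_j`. -/
def HilbertTensor.map (A : ∀ j, H j →L[ℂ] H j) : HilbertTensor H →L[ℂ] HilbertTensor H :=
  (UniformSpace.Completion.toComplL.comp (AlgTensor.mapL A)).extend
    UniformSpace.Completion.toComplL

theorem HilbertTensor.map_coe (A : ∀ j, H j →L[ℂ] H j) (u : AlgTensor H) :
    HilbertTensor.map A (u : HilbertTensor H) = (AlgTensor.map A u : AlgTensor H) := by
  have h := ContinuousLinearMap.extend_eq
    (UniformSpace.Completion.toComplL.comp (AlgTensor.mapL A) : AlgTensor H →L[ℂ] HilbertTensor H)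
    (e := (UniformSpace.Completion.toComplL : AlgTensor H →L[ℂ] HilbertTensor H))
    UniformSpace.Completion.denseRange_coe
    (UniformSpace.Completion.isUniformInducing_coe _) u
  exact h

theorem HilbertTensor.map_tprod (A : ∀ j, H j →L[ℂ] H j) (x : ∀ j, H j) :
    HilbertTensor.map A (HilbertTensor.tprod x) = HilbertTensor.tprod fun j => A j (x j) := by
  rw [HilbertTensor.tprod, HilbertTensor.map_coe, AlgTensor.map_tprod, HilbertTensor.tprod]

theorem HilbertTensor.inner_tprod (x y : ∀ j, H j) :
    ⟪HilbertTensor.tprod x, HilbertTensor.tprod y⟫_ℂ = ∏ j, ⟪x j, y j⟫_ℂ := by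
  rw [HilbertTensor.tprod, HilbertTensor.tprod, UniformSpace.Completion.inner_coe,
    AlgTensor.inner_eq, AlgTensor.form_tprod]

end Hilbert

/-! ### States and measurements -/

/-- A density matrix `ρ = ∑ p_l |ψ_l⟩⟨ψ_l|` on a Hilbert space, given as a countable convex
combination of pure states (unit vectors). -/
structure DensityMatrix (K : Type u) [NormedAddCommGroup K] [InnerProductSpace ℂ K] where
  /-- the probabilities `p_l` -/
  weight : ℕ → ℝ
  /-- the state vectors `ψ_l` -/
  vec : ℕ → K
  weight_nonneg : ∀ l, 0 ≤ weight l
  hasSum_weight : HasSum weight 1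
  norm_vec : ∀ l, ‖vec l‖ = 1

/-- `Tr (ρ T) = ∑ p_l ⟨ψ_l| T |ψ_l⟩`. -/
def DensityMatrix.traceMul {K : Type u} [NormedAddCommGroup K] [InnerProductSpace ℂ K]
    (ρ : DensityMatrix K) (T : K →L[ℂ] K) : ℂ :=
  ∑' l, (ρ.weight l : ℂ) * ⟪ρ.vec l, T (ρ.vec l)⟫_ℂ

/-- A positive operator valued measure with the two outcomes `0`, `1`. -/
structure POVM (K : Type u) [NormedAddCommGroup K] [InnerProductSpace ℂ K] where
  /-- the element `P_m` associated with the outcome `m` -/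
  effect : ZMod 2 → K →L[ℂ] K
  effect_pos : ∀ m, (effect m).IsPositive
  sum_effect : ∑ m, effect m = 1

/-! ### Correlators for `n` parties, each with two inputs and two outputs -/

/-- Bit-strings of length `n`. -/
abbrev Bits (n : ℕ) : Type := Fin n → ZMod 2

/-- The correlator vector `s ↦ p(1|s) = ∑_{m : m_1 ⊕ ⋯ ⊕ m_n = 1} p(m|s)` of a table of conditional
probabilities `p m s = p(m|s)`. -/
def correlator {n : ℕ} (p : Bits n → Bits n → ℝ) : Bits n → ℝ :=
  fun s => ∑ m with ∑ j, m j = 1, p m s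

/-- Conditional probabilities arising from local hidden variables: a convex combination of
deterministic local response functions `g_j`. -/
def IsLHV {n : ℕ} (p : Bits n → Bits n → ℝ) : Prop :=
  ∃ w : (Fin n → ZMod 2 → ZMod 2) → ℝ, (∀ g, 0 ≤ w g) ∧ ∑ g, w g = 1 ∧
    ∀ m s, p m s = ∑ g, w g * ∏ j, if m j = g j (s j) then 1 else 0

/-- Conditional probabilities arising in quantum theory: `p(m|s) = Tr (ρ ⨂ P^{s_j}_{m_j})` for a
density matrix `ρ` on a tensor product of Hilbert spaces of arbitrary (possibly infinite) dimension,
one for each party, and POVMs `P^{s_j}` for the inputs of each party. -/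
def IsQuantum {n : ℕ} (p : Bits n → Bits n → ℝ) : Prop :=
  ∃ (H : Fin n → Type u) (_ : ∀ j, NormedAddCommGroup (H j))
    (_ : ∀ j, InnerProductSpace ℂ (H j)) (_ : ∀ j, CompleteSpace (H j))
    (ρ : DensityMatrix (HilbertTensor H)) (P : ∀ j, ZMod 2 → POVM (H j)),
    ∀ m s, (p m s : ℂ) = ρ.traceMul (HilbertTensor.map fun j => (P j (s j)).effect (m j))

/-- The space `𝓟` of all possible correlators. -/
def allCorrelators (n : ℕ) : Set (Bits n → ℝ) := {x | ∀ s, 0 ≤ x s ∧ x s ≤ 1}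

/-- The space `𝓛` of local hidden variable correlators. -/
def lhvCorrelators (n : ℕ) : Set (Bits n → ℝ) := {x | ∃ p, IsLHV p ∧ x = correlator p}

/-- The space `𝓠` of quantum correlators. -/
def quantumCorrelators (n : ℕ) : Set (Bits n → ℝ) := {x | ∃ p, IsQuantum.{u} p ∧ x = correlator p}

/-- The Bell expression `∑_s β_s p(1|s)`. -/
def bellExpression {n : ℕ} (β x : Bits n → ℝ) : ℝ := ∑ s, β s * x s

/-- `∑_s β_s p(1|s) ≤ γ` is a Bell inequality: `γ` is the tight upper bound over all local hidden
variable correlators. -/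
def IsBellInequality {n : ℕ} (β : Bits n → ℝ) (γ : ℝ) : Prop :=
  IsGreatest (bellExpression β '' lhvCorrelators n) γ

/-- A Bell inequality is non-trivial if some correlator in the space of all correlators
violates it. -/
def IsNontrivialBellInequality {n : ℕ} (β : Bits n → ℝ) (γ : ℝ) : Prop :=
  IsBellInequality β γ ∧ ∃ x ∈ allCorrelators n, γ < bellExpression β x

/-- The `n`-partite NAND function `s_1 s_2 ⋯ s_n ⊕ 1`. -/
def nand {n : ℕ} (s : Bits n) : ZMod 2 := ∏ j, s j + 1

/-- The coefficients `2⁻ⁿ (-1)^{f(s)+1}` for the NAND function `f` and uniform input weights. -/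
def nandCoeff (n : ℕ) (s : Bits n) : ℝ := 1 / 2 ^ n * (-1) ^ ((nand s).val + 1)

end Bell

end

open scoped InnerProductSpace TensorProduct ComplexOrder ComplexConjugate

namespace Bell

/-! ### Functoriality and multilinearity of the tensor product of operators -/

section Tensor

variable {ι : Type} [Fintype ι] {H : ι → Type u} [∀ j, NormedAddCommGroup (H j)]
  [∀ j, InnerProductSpace ℂ (H j)]

/-! Write p(1|s) = (1 - E(s))/2, where E(s) is the expectation of the product of the ±1-valued
outcomes. With σ(s) = -1 at the all-ones input and +1 elsewhere, the inequality becomes ∑ (1 + σ(s)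
E(s)) ≥ 2. Since |E| ≤ 1, every summand is nonnegative, so it is enough to keep the eight inputs
where three chosen parties vary and all others receive 1. The claim is then the three-party bound ∑
σE ≥ -6 (`bellExpression_nand_le`).

For a pure state, E = Re ⟪ψ, X_a Y_b Z_c φ⟫ with contractions X, Y, Z acting on the three tensor
factors, the remaining observables being absorbed into φ. The bound -6 follows from a sum-of-squares
estimate for contractions (`norm_add_norm_le_six`, `neg_six_le_re_inner`); no commutation is used
there. Deterministic local strategies are the case of scalars ±1 on ℂ. Mixed states and hidden
variables follow by convexity (`bellExpression_le_of_hasSum`).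

A constant output of parity 1 attains the bound; the NAND function itself, taken as a correlator,
exceeds it. -/

theorem HilbertTensor.ext_coe {S T : HilbertTensor H →L[ℂ] HilbertTensor H}
    (h : ∀ x : AlgTensor H, S (x : HilbertTensor H) = T (x : HilbertTensor H)) : S = T := by
  ext x
  induction x using UniformSpace.Completion.induction_on with
  | hp => exact isClosed_eq S.continuous T.continuous
  | ih x => exact h x

theorem HilbertTensor.map_comp (A B : ∀ j, H j →L[ℂ] H j) :
    HilbertTensor.map (fun j => (A j).comp (B j)) =
      (HilbertTensor.map A).comp (HilbertTensor.map B) := by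
  refine HilbertTensor.ext_coe fun x => ?_
  rw [ContinuousLinearMap.comp_apply, HilbertTensor.map_coe, HilbertTensor.map_coe,
    HilbertTensor.map_coe]
  congr 1
  exact LinearMap.congr_fun (PiTensorProduct.map_comp (fun j => (A j).toLinearMap)
    (fun j => (B j).toLinearMap)) x

theorem HilbertTensor.map_one :
    HilbertTensor.map (fun j => (1 : H j →L[ℂ] H j)) = 1 := by
  refine HilbertTensor.ext_coe fun x => ?_
  rw [HilbertTensor.map_coe]
  exact congrArg _ (LinearMap.congr_fun (PiTensorProduct.map_id (R := ℂ) (s := H)) x)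

/-- Expansion of a tensor product of linear combinations of operators. -/
theorem HilbertTensor.map_sum_smul [DecidableEq ι] {κ : Type} [Fintype κ] (c : κ → ℂ)
    (P : ∀ j, κ → H j →L[ℂ] H j) :
    HilbertTensor.map (fun j => ∑ m, c m • P j m) =
      ∑ m : ι → κ, (∏ j, c (m j)) • HilbertTensor.map fun j => P j (m j) := by
  refine HilbertTensor.ext_coe fun x => ?_
  simp only [sum_apply, smul_apply, HilbertTensor.map_coe]
  have h : (PiTensorProduct.map fun j => (∑ m, c m • P j m : H j →L[ℂ] H j).toLinearMap) =
      ∑ m : ι → κ, (∏ j, c (m j)) • PiTensorProduct.map fun j => (P j (m j)).toLinearMap := by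
    have e : (fun j => (∑ m, c m • P j m : H j →L[ℂ] H j).toLinearMap) =
        fun j => ∑ m, c m • (P j m).toLinearMap := by
      funext j
      ext y
      simp
    rw [e]
    have h1 := (PiTensorProduct.mapMultilinear ℂ H H).map_sum
      (fun j m => c m • (P j m).toLinearMap)
    simp only [MultilinearMap.map_smul_univ] at h1
    exact h1
  have hx := LinearMap.congr_fun h x
  have e : AlgTensor.map (fun j => ∑ m, c m • P j m) x =
      ∑ m : ι → κ, (∏ j, c (m j)) • AlgTensor.map (fun j => P j (m j)) x := by
    refine hx.trans ?_
    exact LinearMap.sum_apply _ _ _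
  rw [e]
  simp_rw [← UniformSpace.Completion.coe_smul]
  exact map_sum (UniformSpace.Completion.toComplL (𝕜 := ℂ) (E := AlgTensor H))
    (fun m : ι → κ => (∏ j, c (m j)) • AlgTensor.map (fun j => P j (m j)) x) Finset.univ

theorem HilbertTensor.norm_map_apply_le {A : ∀ j, H j →L[ℂ] H j} (hA : ∀ j, ‖A j‖ ≤ 1)
    (x : HilbertTensor H) : ‖HilbertTensor.map A x‖ ≤ ‖x‖ := by
  induction x using UniformSpace.Completion.induction_on with
  | hp => exact isClosed_le (HilbertTensor.map A).continuous.norm continuous_norm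
  | ih x =>
    rw [HilbertTensor.map_coe, UniformSpace.Completion.norm_coe, UniformSpace.Completion.norm_coe]
    refine (AlgTensor.norm_map_le A x).trans (mul_le_of_le_one_left (norm_nonneg _) ?_)
    exact Finset.prod_le_one (fun j _ => norm_nonneg _) fun j _ => hA j

end Tensor

/-! ### The three-party inequality -/

section ThreeParty

variable {K : Type*} [SeminormedAddCommGroup K] [InnerProductSpace ℂ K]

/-- Let u = a + b, v = a - b, and let p, q be the two norms. Expanding p² + 2q² gives the cross term
2 Re ⟪Au, B(u + 2v)⟫ ≤ ‖Au‖² + ‖B(u + 2v)‖². Contractivity then yields p² + 2q² ≤ 5‖u‖² + 2‖v‖² +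
‖3a - b‖² = 16‖a‖² + 8‖b‖² ≤ 24, the inner products of a and b cancelling. -/
theorem norm_add_norm_le_six {A B : K →L[ℂ] K} (hA : ∀ x, ‖A x‖ ≤ ‖x‖)
    (hB : ∀ x, ‖B x‖ ≤ ‖x‖) {a b : K} (ha : ‖a‖ ≤ 1) (hb : ‖b‖ ≤ 1) :
    ‖A (a + b) + B (a + b)‖ + ‖A (a + b) + B (a - b)‖ ≤ 6 := by
  have e1 := norm_add_sq (𝕜 := ℂ) (A (a + b)) (B (a + b))
  have e2 := norm_add_sq (𝕜 := ℂ) (A (a + b)) (B (a - b))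
  have e3 := norm_sub_sq (𝕜 := ℂ) (A (a + b)) (B (3 • a - b))
  -- 3a - b = u + 2v merges the two cross terms into one.
  have e4 : B (3 • a - b) = B (a + b) + (2 : ℂ) • B (a - b) := by
    rw [← map_smul, ← map_add]
    congr 1
    module
  have e5 : RCLike.re ⟪A (a + b), B (3 • a - b)⟫_ℂ =
      RCLike.re ⟪A (a + b), B (a + b)⟫_ℂ + 2 * RCLike.re ⟪A (a + b), B (a - b)⟫_ℂ := by
    rw [e4, inner_add_right, inner_smul_right]
    simp
  have n1 := norm_add_sq (𝕜 := ℂ) a b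
  have n2 := norm_sub_sq (𝕜 := ℂ) a b
  have n3 := norm_sub_sq (𝕜 := ℂ) ((3 : ℂ) • a) b
  have n4 : (3 : ℂ) • a = (3 : ℕ) • a := by module
  have n5 : RCLike.re ⟪(3 : ℂ) • a, b⟫_ℂ = 3 * RCLike.re ⟪a, b⟫_ℂ := by
    rw [inner_smul_left]
    simp
  have n6 : ‖(3 : ℂ) • a‖ = 3 * ‖a‖ := by
    rw [norm_smul]
    norm_num
  rw [n5, n6, n4] at n3
  rw [e5] at e3
  have s1 := pow_le_pow_left₀ (norm_nonneg _) (hA (a + b)) 2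
  have s2 := pow_le_pow_left₀ (norm_nonneg _) (hB (a + b)) 2
  have s3 := pow_le_pow_left₀ (norm_nonneg _) (hB (a - b)) 2
  have s4 := pow_le_pow_left₀ (norm_nonneg _) (hB (3 • a - b)) 2
  have t1 := pow_le_one₀ (n := 2) (norm_nonneg _) ha
  have t2 := pow_le_one₀ (n := 2) (norm_nonneg _) hb
  have q0 := sq_nonneg ‖A (a + b) - B (3 • a - b)‖
  -- Tangents at the equality case p = 4, q = 2 (A = B = 1, a = b a unit vector): p ≤ p²/8 + 2 and q
  -- ≤ q²/4 + 1, so p + q ≤ (p² + 2q²)/8 + 3 ≤ 6.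
  have q1 := sq_nonneg (‖A (a + b) + B (a + b)‖ - 4)
  have q2 := sq_nonneg (‖A (a + b) + B (a - b)‖ - 2)
  nlinarith

/-- For contractions `X a`, `Y b`, `Z c`, the three-party NAND expression is at least `-6`. -/
theorem neg_six_le_re_inner {X Y Z : ZMod 2 → K →L[ℂ] K} (hX : ∀ a x, ‖X a x‖ ≤ ‖x‖)
    (hY : ∀ a x, ‖Y a x‖ ≤ ‖x‖) (hZ : ∀ a x, ‖Z a x‖ ≤ ‖x‖) {φ ψ : K} (hφ : ‖φ‖ ≤ 1)
    (hψ : ‖ψ‖ ≤ 1) {E : ZMod 2 → ZMod 2 → ZMod 2 → ℝ}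
    (hE : ∀ a b c, E a b c = (⟪ψ, X a (Y b (Z c φ))⟫_ℂ).re) :
    -6 ≤ E 0 0 0 + E 0 0 1 + E 0 1 0 + E 0 1 1 + E 1 0 0 + E 1 0 1 + E 1 1 0 - E 1 1 1 := by
  set u := Z 0 φ + Z 1 φ
  set v := Z 0 φ - Z 1 φ
  have h := norm_add_norm_le_six (hY 0) (hY 1) ((hZ 0 φ).trans hφ) ((hZ 1 φ).trans hφ)
  have e : E 0 0 0 + E 0 0 1 + E 0 1 0 + E 0 1 1 + E 1 0 0 + E 1 0 1 + E 1 1 0 - E 1 1 1 =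
      (⟪ψ, X 0 (Y 0 u + Y 1 u) + X 1 (Y 0 u + Y 1 v)⟫_ℂ).re := by
    simp only [hE, u, v, map_add, map_sub, inner_add_right, inner_sub_right, Complex.add_re,
      Complex.sub_re]
    ring
  rw [e]
  have h1 : ‖X 0 (Y 0 u + Y 1 u) + X 1 (Y 0 u + Y 1 v)‖ ≤ 6 :=
    (norm_add_le _ _).trans ((add_le_add (hX _ _) (hX _ _)).trans h)
  have h2 := (Complex.abs_re_le_norm _).trans
    (norm_inner_le_norm (𝕜 := ℂ) ψ (X 0 (Y 0 u + Y 1 u) + X 1 (Y 0 u + Y 1 v)))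
  have h3 := mul_le_mul hψ h1 (norm_nonneg _) zero_le_one
  linarith [(abs_le.1 h2).1]

end ThreeParty

/-! ### Correlators and signs -/

/-- The sign `(-1)^x` of a bit `x`. -/
def bitSign (x : ZMod 2) : ℝ := (-1) ^ x.val

@[simp] theorem bitSign_zero : bitSign 0 = 1 := by simp [bitSign]

@[simp] theorem bitSign_one : bitSign 1 = -1 := by simp [bitSign, ZMod.val_one]

theorem zmod_two_cases (x : ZMod 2) : x = 0 ∨ x = 1 := by
  revert x
  decide

theorem bitSign_add (x y : ZMod 2) : bitSign (x + y) = bitSign x * bitSign y := by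
  rcases zmod_two_cases x with rfl | rfl <;> rcases zmod_two_cases y with rfl | rfl <;>
    simp [show (1 + 1 : ZMod 2) = 0 from rfl]

theorem abs_bitSign (x : ZMod 2) : |bitSign x| = 1 := by
  rcases zmod_two_cases x with rfl | rfl <;> simp

theorem bitSign_sum {ι : Type*} (S : Finset ι) (m : ι → ZMod 2) :
    bitSign (∑ j ∈ S, m j) = ∏ j ∈ S, bitSign (m j) := by
  classical
  induction S using Finset.induction_on with
  | empty => simp
  | insert i S hi ih => rw [Finset.sum_insert hi, Finset.prod_insert hi, bitSign_add, ih]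

/-- The expectation value of the product of the outcomes, written as signs. -/
def expectation {n : ℕ} (p : Bits n → Bits n → ℝ) (s : Bits n) : ℝ :=
  ∑ m : Bits n, (∏ j, bitSign (m j)) * p m s

/-- The indicator of odd parity is (1 - ∏ (-1)^{m_j})/2. -/
theorem correlator_eq {n : ℕ} (p : Bits n → Bits n → ℝ) (s : Bits n) :
    correlator p s = (∑ m, p m s - expectation p s) / 2 := by
  rw [correlator, expectation, ← Finset.sum_sub_distrib, Finset.sum_div, Finset.sum_filter]
  refine Finset.sum_congr rfl fun m _ => ?_
  rw [← bitSign_sum]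
  rcases zmod_two_cases (∑ j, m j) with h | h <;> simp [h]

theorem nandCoeff_eq {n : ℕ} (s : Bits n) :
    nandCoeff n s = 1 / 2 ^ n * if s = 1 then -1 else 1 := by
  rw [nandCoeff]
  congr 1
  split_ifs with h
  · simp [nand, h, show (1 + 1 : ZMod 2) = 0 from rfl]
  · obtain ⟨j, hj⟩ := Function.ne_iff.1 h
    have : ∏ j, s j = 0 :=
      Finset.prod_eq_zero (Finset.mem_univ j) ((zmod_two_cases (s j)).resolve_right hj)
    simp [nand, this, ZMod.val_one]

theorem sum_nandSign (n : ℕ) : ∑ s : Bits n, (if s = 1 then (-1 : ℝ) else 1) = 2 ^ n - 2 := by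
  have e : ∀ s : Bits n, (if s = 1 then (-1 : ℝ) else 1) = 1 - if s = 1 then 2 else 0 := by
    intro s
    split_ifs <;> norm_num
  simp [e, Finset.sum_sub_distrib, ZMod.card]

/-- The input string with entries `a`, `b`, `c` at `i`, `j`, `k` and `1` elsewhere. -/
def threeInputs {n : ℕ} (i j k : Fin n) (a b c : ZMod 2) : Bits n :=
  Function.update (Function.update (Function.update 1 k c) j b) i a

theorem exists_three_distinct {n : ℕ} (hn : 3 ≤ n) :
    ∃ i j k : Fin n, i ≠ j ∧ i ≠ k ∧ j ≠ k :=
  ⟨⟨0, by omega⟩, ⟨1, by omega⟩, ⟨2, by omega⟩, by simp, by simp, by simp⟩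

/-- Reduction from n parties to three: fixing the other inputs to 1 keeps the exceptional all-ones
input among the eight retained ones. -/
theorem bellExpression_nand_le {n : ℕ} {i j k : Fin n} (hij : i ≠ j) (hik : i ≠ k) (hjk : j ≠ k)
    {p : Bits n → Bits n → ℝ} (hp : ∀ s, ∑ m, p m s = 1) {E : Bits n → ℝ}
    (hpE : ∀ s, expectation p s = E s) (hE : ∀ s, |E s| ≤ 1)
    (h3 : let F := fun a b c => E (threeInputs i j k a b c);
      -6 ≤ F 0 0 0 + F 0 0 1 + F 0 1 0 + F 0 1 1 + F 1 0 0 + F 1 0 1 + F 1 1 0 - F 1 1 1) :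
    bellExpression (nandCoeff n) (correlator p) ≤ (2 ^ n - 2) / 2 ^ n := by
  have hinj : Function.Injective fun x : ZMod 2 × ZMod 2 × ZMod 2 =>
      threeInputs i j k x.1 x.2.1 x.2.2 := by
    rintro ⟨a, b, c⟩ ⟨a', b', c'⟩ h
    have h1 := congrFun h i
    have h2 := congrFun h j
    have h3 := congrFun h k
    simp_all [threeInputs, hij.symm, hik.symm, hjk.symm]
  have hone : ∀ a b c, threeInputs i j k a b c = 1 ↔ a = 1 ∧ b = 1 ∧ c = 1 := by
    have h1 : threeInputs i j k 1 1 1 = 1 := by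
      funext l
      simp [threeInputs, Function.update_apply]
    intro a b c
    rw [← h1]
    exact (hinj.eq_iff (a := (a, b, c)) (b := (1, 1, 1))).trans (by simp)
  -- The eight retained terms contribute at least 8 - 6 = 2; all others are nonnegative.
  have hsum : 2 ≤ ∑ s : Bits n, (1 + (if s = 1 then -1 else 1) * E s) := by
    have hnn : ∀ s : Bits n, 0 ≤ 1 + (if s = 1 then -1 else 1) * E s := by
      intro s
      have := abs_le.1 (hE s)
      split_ifs <;> linarith
    have hle := Finset.sum_le_sum_of_subset_of_nonneg
      (Finset.subset_univ (Finset.univ.map ⟨_, hinj⟩)) (fun s _ _ => hnn s)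
    refine le_trans ?_ hle
    have h2 : ∀ f : ZMod 2 → ℝ, ∑ x, f x = f 0 + f 1 := fun f => Fin.sum_univ_two f
    rw [Finset.sum_map]
    simp only [Function.Embedding.coeFn_mk, Fintype.sum_prod_type, h2, hone]
    simp only [zero_ne_one, false_and, and_false, and_self, if_false, if_true]
    simp only at h3
    linarith
  have e : bellExpression (nandCoeff n) (correlator p) =
      1 / 2 ^ n * ((2 * (2 ^ n - 2) -
        (∑ s : Bits n, (1 + (if s = 1 then -1 else 1) * E s) - 2)) / 2) := by
    have h1 : ∑ s : Bits n, (1 + (if s = 1 then -1 else 1) * E s) =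
        2 ^ n + ∑ s : Bits n, (if s = 1 then -1 else 1) * E s := by
      simp [Finset.sum_add_distrib, ZMod.card]
    have h2 : bellExpression (nandCoeff n) (correlator p) =
        1 / 2 ^ n * ((∑ s : Bits n, (if s = 1 then (-1 : ℝ) else 1) -
          ∑ s : Bits n, (if s = 1 then -1 else 1) * E s) / 2) := by
      rw [bellExpression, ← Finset.sum_sub_distrib, Finset.sum_div, Finset.mul_sum]
      refine Finset.sum_congr rfl fun s _ => ?_
      rw [nandCoeff_eq, correlator_eq, hp, hpE]
      ring
    rw [h2, sum_nandSign, h1]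
    ring
  rw [e, div_eq_inv_mul (2 ^ n - 2 : ℝ), one_div]
  gcongr
  linarith

/-- A bound on a Bell expression is inherited by countable mixtures. -/
theorem bellExpression_le_of_hasSum {n : ℕ} {κ : Type*} {β : Bits n → ℝ} {γ : ℝ} {w : κ → ℝ}
    (hw : ∀ l, 0 ≤ w l) (hw1 : HasSum w 1) {q : κ → Bits n → Bits n → ℝ}
    {p : Bits n → Bits n → ℝ} (hp : ∀ m s, HasSum (fun l => w l * q l m s) (p m s))
    (hq : ∀ l, bellExpression β (correlator (q l)) ≤ γ) :
    bellExpression β (correlator p) ≤ γ := by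
  have h : HasSum (fun l => w l * bellExpression β (correlator (q l)))
      (bellExpression β (correlator p)) := by
    have h1 : HasSum (fun l => ∑ s, β s * ∑ m with ∑ j, m j = 1, w l * q l m s)
        (bellExpression β (correlator p)) :=
      hasSum_sum fun s _ => (hasSum_sum fun m _ => hp m s).mul_left (β s)
    convert h1 using 2 with l
    simp only [bellExpression, correlator, Finset.mul_sum]
    exact Finset.sum_congr rfl fun s _ => Finset.sum_congr rfl fun m _ => by ring
  have h2 := hw1.mul_right γ
  rw [one_mul] at h2
  exact hasSum_le (fun l => mul_le_mul_of_nonneg_left (hq l) (hw l)) h h2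

/-! ### Local hidden variables -/

/-- The conditional probabilities of the deterministic local strategy `g`. -/
def deterministic {n : ℕ} (g : Fin n → ZMod 2 → ZMod 2) (m s : Bits n) : ℝ :=
  ∏ j, if m j = g j (s j) then 1 else 0

theorem deterministic_eq {n : ℕ} (g : Fin n → ZMod 2 → ZMod 2) (m s : Bits n) :
    deterministic g m s = if m = fun j => g j (s j) then 1 else 0 := by
  simp [deterministic, Finset.prod_ite_zero, funext_iff]

theorem sum_deterministic {n : ℕ} (g : Fin n → ZMod 2 → ZMod 2) (s : Bits n) :
    ∑ m, deterministic g m s = 1 := by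
  simp [deterministic_eq]

theorem expectation_deterministic {n : ℕ} (g : Fin n → ZMod 2 → ZMod 2) (s : Bits n) :
    expectation (deterministic g) s = ∏ j, bitSign (g j (s j)) := by
  simp [expectation, deterministic_eq]

theorem prod_threeInputs {n : ℕ} {M : Type*} [CommMonoid M] {i j k : Fin n} (hij : i ≠ j)
    (hik : i ≠ k) (hjk : j ≠ k) (f : Fin n → ZMod 2 → M) (a b c : ZMod 2) :
    ∏ l, f l (threeInputs i j k a b c l) =
      f i a * (f j b * (f k c * ∏ l ∈ ((Finset.univ.erase i).erase j).erase k, f l 1)) := by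
  have hj : j ∈ Finset.univ.erase i := by simp [hij.symm]
  have hk : k ∈ (Finset.univ.erase i).erase j := by simp [hik.symm, hjk.symm]
  rw [← Finset.mul_prod_erase _ _ (Finset.mem_univ i), ← Finset.mul_prod_erase _ _ hj,
    ← Finset.mul_prod_erase _ _ hk]
  simp only [threeInputs, Function.update_self, Function.update_of_ne hij.symm,
    Function.update_of_ne hik.symm, Function.update_of_ne hjk.symm]
  congr 3
  refine Finset.prod_congr rfl fun l hl => ?_
  simp only [Finset.mem_erase] at hl
  simp [Function.update_of_ne, hl.1, hl.2.1, hl.2.2.1]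

theorem bellExpression_deterministic_le {n : ℕ} (hn : 3 ≤ n) (g : Fin n → ZMod 2 → ZMod 2) :
    bellExpression (nandCoeff n) (correlator (deterministic g)) ≤ (2 ^ n - 2) / 2 ^ n := by
  obtain ⟨i, j, k, hij, hik, hjk⟩ := exists_three_distinct hn
  have habs : ∀ S : Finset (Fin n), ∀ s : Bits n, |∏ j ∈ S, bitSign (g j (s j))| = 1 := by
    intro S s
    rw [Finset.abs_prod]
    exact Finset.prod_eq_one fun j _ => abs_bitSign _
  refine bellExpression_nand_le hij hik hjk (sum_deterministic g) (expectation_deterministic g)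
    (fun s => (habs _ s).le) ?_
  -- The answers act as scalars ±1 on ℂ; the signs of the other parties at input 1 are collected in
  -- φ.
  let X : Fin n → ZMod 2 → ℂ →L[ℂ] ℂ := fun l a => (bitSign (g l a) : ℂ) • 1
  have hX : ∀ l a x, ‖X l a x‖ ≤ ‖x‖ := by
    intro l a x
    simp [X, abs_bitSign]
  refine neg_six_le_re_inner (hX i) (hX j) (hX k)
    (φ := ((∏ l ∈ ((Finset.univ.erase i).erase j).erase k, bitSign (g l 1) : ℝ) : ℂ)) (ψ := (1 : ℂ))
    (E := fun a b c => ∏ l, bitSign (g l (threeInputs i j k a b c l))) ?_ (by simp)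
    fun a b c => ?_
  · rw [Complex.norm_real, Real.norm_eq_abs]
    exact (habs _ 1).le
  · rw [prod_threeInputs hij hik hjk (fun l x => bitSign (g l x))]
    simp only [X, smul_apply, one_apply_eq_self, smul_eq_mul, RCLike.inner_apply,
      map_one, mul_one, ← Complex.ofReal_mul, Complex.ofReal_re]

theorem bellExpression_nand_one (n : ℕ) :
    bellExpression (nandCoeff n) (fun _ => 1) = (2 ^ n - 2) / 2 ^ n := by
  simp only [bellExpression, nandCoeff_eq, mul_one]
  rw [← Finset.mul_sum, sum_nandSign]
  ring

theorem isBellInequality_nand {n : ℕ} (hn : 3 ≤ n) :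
    IsBellInequality (nandCoeff n) ((2 ^ n - 2) / 2 ^ n) := by
  constructor
  -- One party always answers 1 and the others 0, so the parity is 1 on every input.
  · let g : Fin n → ZMod 2 → ZMod 2 := fun j _ => if j = ⟨0, by omega⟩ then 1 else 0
    refine ⟨fun _ => 1, ⟨deterministic g, ⟨Pi.single g 1, fun g' => ?_, by simp, fun m s => ?_⟩,
      ?_⟩, bellExpression_nand_one n⟩
    · by_cases h : g' = g
      · simp [h]
      · simp [h]
    · simp [Pi.single_apply, deterministic]
    · funext s
      rw [correlator_eq, sum_deterministic, expectation_deterministic, ← bitSign_sum]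
      simp [g]
  · rintro _ ⟨_, ⟨p, ⟨w, hw, hw1, hp⟩, rfl⟩, rfl⟩
    refine bellExpression_le_of_hasSum hw (hw1 ▸ hasSum_fintype w) (q := deterministic)
      (fun m s => ?_) (bellExpression_deterministic_le hn)
    rw [hp]
    exact hasSum_fintype _

/-- The witness is NAND itself: dropping the all-ones entry of the constant correlator 1 removes its
only negative contribution, a gain of 2⁻ⁿ. -/
theorem lt_bellExpression_nand (n : ℕ) :
    (2 ^ n - 2) / 2 ^ n < bellExpression (nandCoeff n) (fun s => if s = 1 then 0 else 1) := by
  have h : bellExpression (nandCoeff n) (fun s => if s = 1 then 0 else 1) =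
      (2 ^ n - 2) / 2 ^ n + 1 / 2 ^ n := by
    rw [← bellExpression_nand_one, ← sub_eq_iff_eq_add', bellExpression, bellExpression,
      ← Finset.sum_sub_distrib, Finset.sum_eq_single 1]
    · simp [nandCoeff_eq]
    · intro s _ hs
      simp [hs]
    · simp
  rw [h]
  exact lt_add_of_pos_right _ (by positivity)

/-! ### Quantum correlators -/

section Quantum

/-- The observable `P_0 - P_1` of a two-outcome measurement. -/
def POVM.observable {K : Type u} [NormedAddCommGroup K] [InnerProductSpace ℂ K] (P : POVM K) :
    K →L[ℂ] K :=
  ∑ m, (bitSign m : ℂ) • P.effect m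

/-- ‖P₀x + P₁x‖² - ‖P₀x - P₁x‖² = 4 Re ⟪P₀x, P₁x⟫, and this is nonnegative because P₀ and P₁ = 1 -
P₀ are commuting positive operators. -/
theorem POVM.norm_observable_apply_le {K : Type u} [NormedAddCommGroup K] [InnerProductSpace ℂ K]
    (P : POVM K) (x : K) : ‖P.observable x‖ ≤ ‖x‖ := by
  have hsum : ∀ y, P.effect 0 y + P.effect 1 y = y := by
    intro y
    have h : P.effect 0 + P.effect 1 = 1 := (Fin.sum_univ_two P.effect).symm.trans P.sum_effect
    simpa using congrArg (fun T => T y) h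
  have hobs : P.observable x = P.effect 0 x - P.effect 1 x := by
    have h : P.observable = (bitSign 0 : ℂ) • P.effect 0 + (bitSign 1 : ℂ) • P.effect 1 :=
      Fin.sum_univ_two fun m : ZMod 2 => (bitSign m : ℂ) • P.effect m
    rw [h]
    simp [sub_eq_add_neg]
  have hcomm : P.effect 0 (P.effect 1 x) = P.effect 1 (P.effect 0 x) := by
    have h1 := hsum (P.effect 1 x)
    have h2 : P.effect 1 (P.effect 0 x) + P.effect 1 (P.effect 1 x) = P.effect 1 x := by
      rw [← map_add, hsum]
    exact add_right_cancel (h1.trans h2.symm)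
  have hpos : 0 ≤ RCLike.re ⟪P.effect 0 x, P.effect 1 x⟫_ℂ := by
    -- Inserting 1 = P₀ + P₁ gives P₀P₁ = P₀P₁P₀ + P₁P₀P₁, visibly positive without square roots.
    have h : ⟪P.effect 0 x, P.effect 1 x⟫_ℂ =
        ⟪P.effect 0 x, P.effect 1 (P.effect 0 x)⟫_ℂ +
          ⟪P.effect 1 x, P.effect 0 (P.effect 1 x)⟫_ℂ := by
      have e1 : ⟪P.effect 1 x, P.effect 0 (P.effect 1 x)⟫_ℂ =
          ⟪P.effect 0 x, P.effect 1 (P.effect 1 x)⟫_ℂ := by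
        have s0 := (P.effect_pos 0).isSymmetric (P.effect 1 x) (P.effect 1 x)
        have s1 := (P.effect_pos 1).isSymmetric (P.effect 0 x) (P.effect 1 x)
        simp only [ContinuousLinearMap.coe_coe] at s0 s1
        rw [← s0, hcomm, s1]
      rw [e1, ← inner_add_right, ← map_add, hsum]
    rw [h, map_add]
    exact add_nonneg ((P.effect_pos 1).re_inner_nonneg_right _)
      ((P.effect_pos 0).re_inner_nonneg_right _)
  have h1 := norm_add_sq (𝕜 := ℂ) (P.effect 0 x) (P.effect 1 x)
  have h2 := norm_sub_sq (𝕜 := ℂ) (P.effect 0 x) (P.effect 1 x)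
  rw [hsum] at h1
  rw [← hobs] at h2
  exact abs_le_of_sq_le_sq' (by linarith) (norm_nonneg _) |>.2

variable {n : ℕ} {H : Fin n → Type u} [∀ j, NormedAddCommGroup (H j)]
  [∀ j, InnerProductSpace ℂ (H j)]

/-- The conditional probabilities of measurements on the pure state `ψ`. -/
noncomputable def pureProb (P : ∀ j, ZMod 2 → POVM (H j)) (ψ : HilbertTensor H) (m s : Bits n) : ℝ :=
  (⟪ψ, HilbertTensor.map (fun j => (P j (s j)).effect (m j)) ψ⟫_ℂ).re

/-- Weights c = 1 give normalization; sign weights give the expectation as a tensor product of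
observables. -/
theorem sum_mul_pureProb (P : ∀ j, ZMod 2 → POVM (H j)) (ψ : HilbertTensor H) (c : ZMod 2 → ℝ)
    (s : Bits n) :
    ∑ m : Bits n, (∏ j, c (m j)) * pureProb P ψ m s =
      (⟪ψ, HilbertTensor.map (fun j => ∑ m, (c m : ℂ) • (P j (s j)).effect m) ψ⟫_ℂ).re := by
  rw [HilbertTensor.map_sum_smul (fun m => (c m : ℂ)) fun j => (P j (s j)).effect]
  rw [sum_apply, inner_sum, Complex.re_sum]
  refine Finset.sum_congr rfl fun m _ => ?_
  rw [smul_apply, inner_smul_right, ← Complex.ofReal_prod, Complex.re_ofReal_mul, pureProb]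

theorem sum_pureProb (P : ∀ j, ZMod 2 → POVM (H j)) {ψ : HilbertTensor H} (hψ : ‖ψ‖ = 1)
    (s : Bits n) : ∑ m, pureProb P ψ m s = 1 := by
  have h := sum_mul_pureProb P ψ (fun _ => 1) s
  simp only [Finset.prod_const_one, one_mul, Complex.ofReal_one, one_smul, POVM.sum_effect,
    HilbertTensor.map_one, one_apply_eq_self] at h
  rw [h, inner_self_eq_norm_sq_to_K, hψ]
  simp

theorem expectation_pureProb (P : ∀ j, ZMod 2 → POVM (H j)) (ψ : HilbertTensor H) (s : Bits n) :
    expectation (pureProb P ψ) s =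
      (⟪ψ, HilbertTensor.map (fun j => (P j (s j)).observable) ψ⟫_ℂ).re :=
  sum_mul_pureProb P ψ bitSign s

/-- Factors each of the three varying parties into an operator that is the identity on all other
tensor factors; the innermost operator does not depend on a, b, c. -/
theorem HilbertTensor.map_threeInputs {i j k : Fin n} (hij : i ≠ j) (hik : i ≠ k) (hjk : j ≠ k)
    (A : ∀ l, ZMod 2 → H l →L[ℂ] H l) (a b c : ZMod 2) (x : HilbertTensor H) :
    HilbertTensor.map (fun l => A l (threeInputs i j k a b c l)) x =
      HilbertTensor.map (Function.update 1 i (A i a))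
        (HilbertTensor.map (Function.update 1 j (A j b))
          (HilbertTensor.map (Function.update 1 k (A k c))
            (HilbertTensor.map (Function.update (Function.update (Function.update
              (fun l => A l 1) i 1) j 1) k 1) x))) := by
  simp only [← ContinuousLinearMap.comp_apply, ← HilbertTensor.map_comp]
  congr 2
  funext l
  by_cases hi : l = i
  · subst hi
    ext y
    simp [threeInputs, Function.update_of_ne, hij, hik]
  by_cases hj : l = j
  · subst hj
    ext y
    simp [threeInputs, Function.update_of_ne, hi, hjk]
  by_cases hk : l = k
  · subst hk
    ext y
    simp [threeInputs, Function.update_of_ne, hi, hj]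
  ext y
  simp [threeInputs, Function.update_of_ne, hi, hj, hk]

theorem bellExpression_pureProb_le (hn : 3 ≤ n) (P : ∀ j, ZMod 2 → POVM (H j))
    {ψ : HilbertTensor H} (hψ : ‖ψ‖ = 1) :
    bellExpression (nandCoeff n) (correlator (pureProb P ψ)) ≤ (2 ^ n - 2) / 2 ^ n := by
  obtain ⟨i, j, k, hij, hik, hjk⟩ := exists_three_distinct hn
  have hA : ∀ j a, ‖(P j a).observable‖ ≤ 1 := fun j a =>
    ContinuousLinearMap.opNorm_le_bound _ zero_le_one fun x => by
      simpa using (P j a).norm_observable_apply_le x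
  have hid : ∀ j, ‖(1 : H j →L[ℂ] H j)‖ ≤ 1 := fun j => ContinuousLinearMap.norm_id_le
  have hupd : ∀ (f : ∀ j, H j →L[ℂ] H j) (_ : ∀ j, ‖f j‖ ≤ 1) (i : Fin n) (T : H i →L[ℂ] H i)
      (_ : ‖T‖ ≤ 1) (j : Fin n), ‖Function.update f i T j‖ ≤ 1 := by
    intro f hf i T hT j
    by_cases h : j = i
    · subst h
      simpa using hT
    · simpa [h] using hf j
  have hX : ∀ j a (x : HilbertTensor H),
      ‖HilbertTensor.map (Function.update 1 j (P j a).observable) x‖ ≤ ‖x‖ := fun j a =>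
    HilbertTensor.norm_map_apply_le (hupd _ hid j _ (hA j a))
  refine bellExpression_nand_le hij hik hjk (sum_pureProb P hψ) (expectation_pureProb P ψ)
    (fun s => ?_) ?_
  · refine (Complex.abs_re_le_norm _).trans ((norm_inner_le_norm (𝕜 := ℂ) _ _).trans ?_)
    rw [hψ, one_mul, ← hψ]
    exact HilbertTensor.norm_map_apply_le (fun j => hA j (s j)) ψ
  · refine neg_six_le_re_inner (hX i) (hX j) (hX k)
      -- φ is ψ acted on by the other parties' observables at input 1, hence of norm at most 1.
      (φ := HilbertTensor.map (Function.update (Function.update (Function.update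
        (fun l => (P l 1).observable) _ 1) _ 1) _ 1) ψ) (ψ := ψ) ?_ hψ.le fun a b c =>
        congrArg (fun x => (⟪ψ, x⟫_ℂ).re)
          (HilbertTensor.map_threeInputs hij hik hjk (fun l x => (P l x).observable) a b c ψ)
    refine (HilbertTensor.norm_map_apply_le ?_ ψ).trans hψ.le
    exact hupd _ (hupd _ (hupd _ (fun j => hA j 1) _ _ (hid _)) _ _ (hid _)) _ _ (hid _)

end Quantum

/-- The series is dominated by the summable `weight l * ‖T‖`, so the `tsum` in `traceMul` is a
genuine sum. -/
theorem DensityMatrix.hasSum_traceMul {K : Type u} [NormedAddCommGroup K] [InnerProductSpace ℂ K]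
    (ρ : DensityMatrix K) (T : K →L[ℂ] K) :
    HasSum (fun l => (ρ.weight l : ℂ) * ⟪ρ.vec l, T (ρ.vec l)⟫_ℂ) (ρ.traceMul T) := by
  refine Summable.hasSum (Summable.of_norm_bounded (ρ.hasSum_weight.summable.mul_right ‖T‖) ?_)
  intro l
  rw [norm_mul, Complex.norm_real, Real.norm_of_nonneg (ρ.weight_nonneg l)]
  refine mul_le_mul_of_nonneg_left ?_ (ρ.weight_nonneg l)
  have h1 := norm_inner_le_norm (𝕜 := ℂ) (ρ.vec l) (T (ρ.vec l))
  have h2 := T.le_opNorm (ρ.vec l)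
  rw [ρ.norm_vec, mul_one] at h2
  rw [ρ.norm_vec, one_mul] at h1
  exact h1.trans h2

theorem bellExpression_quantum_le {n : ℕ} (hn : 3 ≤ n) {x : Bits n → ℝ}
    (hx : x ∈ quantumCorrelators.{u} n) :
    bellExpression (nandCoeff n) x ≤ (2 ^ n - 2) / 2 ^ n := by
  obtain ⟨p, ⟨H, _, _, _, ρ, P, hp⟩, rfl⟩ := hx
  refine bellExpression_le_of_hasSum ρ.weight_nonneg ρ.hasSum_weight
    (q := fun l => pureProb P (ρ.vec l)) (fun m s => ?_)
    fun l => bellExpression_pureProb_le hn P (ρ.norm_vec l)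
  -- Taking real parts exhibits p as the countable mixture of the pure-state tables.
  have h := Complex.hasSum_re (ρ.hasSum_traceMul
    (HilbertTensor.map fun j => (P j (s j)).effect (m j)))
  rw [← hp, Complex.ofReal_re] at h
  simpa only [Complex.re_ofReal_mul, pureProb] using h

end Bell

theorem proposition3p3p2 (n : ℕ) (hn : 3 ≤ n) :
    Bell.IsNontrivialBellInequality (Bell.nandCoeff n) ((2 ^ n - 2) / 2 ^ n) ∧
      ∀ p ∈ Bell.quantumCorrelators.{u} n,
        Bell.bellExpression (Bell.nandCoeff n) p ≤ (2 ^ n - 2) / 2 ^ n := by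
  refine ⟨⟨Bell.isBellInequality_nand hn, _, fun s => ?_, Bell.lt_bellExpression_nand n⟩,
    fun p hp => Bell.bellExpression_quantum_le hn hp⟩
  split_ifs <;> norm_num
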